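/- Let $k$ be a commutative ring, $A$ a commutative $k$-algebra and $I\subseteq A$ an ideal. A Hasse-Schmidt derivation of $A$ over $k$ of length $m\ge 1$ is a sequence $D=(D_0,\dots,D_m)$ of $k$-linear maps $A\to A$ with $D_0=\mathrm{Id}_A$ and $D_n(xy)=\sum_{i+j=n}D_i(x)D_j(y)$ for all $x,y\in A$ and $n\le m$; $\mathrm{HS}_k(A;m)$ is the set of these. Such a $D$ is $r$-$I$-logarithmic if $D_i(I)\subseteq I$ for all $i\le r$, and $I$-logarithmic if $D_i(I)\subseteq I$ for all $i\le m$. Put $\ell(D)=\min\{h\ge 1: D_h\ne 0\}$, with $\ell(D)=\infty$ if $D_h=0$ for all $1\le h\le m$. An $m$-integral of a $k$-derivation $\delta$ of $A$ is a $D\in\mathrm{HS}_k(A;m)$ with $D_1=\delta$, and $\mathrm{IDer}_k(\log I;m)$ is the set of $k$-derivations of $A$ that have an $I$-logarithmic $m$-integral. **Theorem 3.14.** Let $p\ge 2$ and $a\ge 1$ be integers, and suppose that $A$ satisfies $H^I_{p,a}$: for every integer $M$ with $1<M<p^a$ that is not a power of $p$, $\mathrm{IDer}_k(\log I;M-1)=\mathrm{IDer}_k(\log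 I;M)$. Let $e,s\ge 1$ be integers with $s\le a$, and let $D\in\mathrm{HS}_k(A;ep^s)$ be $(ep^s-1)$-$I$-logarithmic with $\ell(D)\ge e$. Then there exists $D'\in\mathrm{HS}_k(A;p^s)$ which is a $p^s$-integral of $D_e$ (in particular $D_e$ is a $k$-derivation), which is $(p^s-1)$-$I$-logarithmic, and for which $$D'_{p^s}=D_{ep^s}+H$$ for some $k$-linear differential operator $H$ of $A$ (of finite order, in the sense of Grothendieck) with $H(I)\subseteq I$. -/

import Mathlib

/-- A Hasse-Schmidt derivation of `A` over `k` of finite length `m`: `k`-linear maps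
`D_0, ..., D_m : A → A` with `D_0 = id` and `D_n (x y) = ∑_{i+j=n} D_i x * D_j y` for `n ≤ m`.
The sequence is indexed by all of `ℕ` and, so that it carries exactly the data `D_0, ..., D_m`,
it is required to vanish beyond the length `m`. -/
structure HSDer (k A : Type*) [CommRing k] [CommRing A] [Algebra k A] (m : ℕ) where
  comp : ℕ → Module.End k A
  comp_zero : comp 0 = LinearMap.id
  comp_mul : ∀ n ≤ m, ∀ x y : A,
    comp n (x * y) = ∑ ij ∈ Finset.HasAntidiagonal.antidiagonal n, comp ij.1 x * comp ij.2 y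
  comp_of_lt : ∀ n, m < n → comp n = 0

namespace HSDer

variable {k A : Type*} [CommRing k] [CommRing A] [Algebra k A] {m : ℕ}

/-- `D` is `r`-`I`-logarithmic: its truncation `(D_0, ..., D_r)` preserves `I`. -/
def IsLogarithmicUpTo (D : HSDer k A m) (I : Ideal A) (r : ℕ) : Prop :=
  ∀ i ≤ r, ∀ x ∈ I, D.comp i x ∈ I

/-- `D` is `I`-logarithmic: `D_i (I) ⊆ I` for all `i` (up to the length of `D`). -/
def IsLogarithmic (D : HSDer k A m) (I : Ideal A) : Prop :=
  D.IsLogarithmicUpTo I m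

/-- `ℓ(D)`: the least `h ≥ 1` with `D_h ≠ 0`, and `∞` if there is none. -/
noncomputable def ell (D : HSDer k A m) : ℕ∞ :=
  ⨅ (h : ℕ) (_ : 1 ≤ h ∧ D.comp h ≠ 0), (h : ℕ∞)

/-- `D`, of length `m ≥ 1`, is an `m`-integral of the map `δ`: the truncation of `D` to length `1`
is `(id, δ)`. Only a derivation `δ` can have an integral. -/
def IsIntegralOf (D : HSDer k A m) (δ : Module.End k A) : Prop :=
  1 ≤ m ∧ D.comp 1 = δ

end HSDer

/-- `IDer_k(log I; n)`: the `I`-logarithmically `n`-integrable `k`-derivations of `A`, for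
`n ≥ 1`. -/
def LogIDer (k : Type*) {A : Type*} [CommRing k] [CommRing A] [Algebra k A]
    (I : Ideal A) (n : ℕ) : Set (Derivation k A A) :=
  {δ | ∃ E : HSDer k A n, E.IsLogarithmic I ∧ E.IsIntegralOf (δ : A →ₗ[k] A)}

/-- The condition `H^I_{p,a}`: no `I`-logarithmic leap at an integer `1 < M < p^a` that is not a
power of `p`. -/
def NoLogLeapsBelow (k : Type*) {A : Type*} [CommRing k] [CommRing A] [Algebra k A]
    (I : Ideal A) (p a : ℕ) : Prop :=
  ∀ M : ℕ, 1 < M → M < p ^ a → (∀ j : ℕ, M ≠ p ^ j) → LogIDer k I (M - 1) = LogIDer k I M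

/-- `k`-linear differential operators of `A` of order at most `n` (Grothendieck): those of order
at most `0` commute with multiplications, and `P` has order at most `n + 1` if all commutators
`[P, b]` with multiplication by `b : A` have order at most `n`. -/
def IsDiffOpOfOrderLE {k A : Type*} [CommRing k] [CommRing A] [Algebra k A] :
    ℕ → Module.End k A → Prop
  | 0, P => ∀ b : A, P * LinearMap.mulLeft k b - LinearMap.mulLeft k b * P = 0
  | n + 1, P => ∀ b : A,
      IsDiffOpOfOrderLE n (P * LinearMap.mulLeft k b - LinearMap.mulLeft k b * P)

/-- `H` is a `k`-linear differential operator of `A` (of some finite order) with `H (I) ⊆ I`. -/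
def IsLogDiffOp {k A : Type*} [CommRing k] [CommRing A] [Algebra k A]
    (I : Ideal A) (H : Module.End k A) : Prop :=
  (∃ n : ℕ, IsDiffOpOfOrderLE n H) ∧ ∀ x ∈ I, H x ∈ I

/-!
A Hasse-Schmidt derivation is treated as a power series `∑ D_i t^i` over the noncommutative ring
`Module.End k A`. The bilinear map measuring the failure of its Leibniz rule in degree `n`, the
*defect* `leibnizDefect`, is additive on products of series that obey the Leibniz rules in all
lower degrees (`leibnizDefect_mul`). The coefficients of logarithmic Hasse-Schmidt derivations are
logarithmic differential operators (`IsLogHSMod.isLogDiffOp_coeff`), and so are their products.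

Put `N = e p^s`. The theorem is proved by strong induction on `s`. Modulo `t^N`, the series `D` is
a product of factors `E_j (t^j)` for `e ≤ j < N`, where `E_j` is an `I`-logarithmic integral of the
leading coefficient of what remains after splitting off the earlier factors. That leading
coefficient is integrable by induction on `s`, first up to length `p^σ` with `j p^σ < N`, then, in
the absence of leaps, up to length `p^(σ+1) - 1`, where `N ≤ j p^(σ+1)`
(`IsLogHSMod.exists_integral`).

Let `P` be the product of these factors, so that `D = P` modulo `t^N`. As `D` is a Hasse-Schmidt
derivation of length `N`, adding `(D_N - P_N) t^N` to `P` makes the defect of `P` in degree `N`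
vanish. That defect is the sum of those of the factors. Only the factors with
`j = e p^i`, `i < s`, contribute a defect. Hence the product `Q` of the corresponding
`E_j (t^(p^i))` has in degree `p^s` the defect that `P` has in degree `N`
(`exists_factorization`). So the operator `D_N - P_N` that corrects `P` also corrects
`Q`, and `D' = Q + (D_N - P_N) t^(p^s)` is the required integral (`hasPowIntegrals`). Here
`D'_{p^s} - D_N = Q_{p^s} - P_N` is a logarithmic differential operator, since `P` and `Q` are
products of series all of whose coefficients are such operators.
-/

open Finset hiding mem_antidiagonal antidiagonal
open Finset.HasAntidiagonal

/-! ### The defect of the Leibniz rule -/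

section LeibnizSeries

variable {k A : Type*} [CommRing k] [CommRing A] [Algebra k A]

/-- The failure of the Leibniz rule of order `n` for a series `F = ∑ F_i t^i` of `k`-linear
endomorphisms of `A`. -/
noncomputable def leibnizDefect (F : PowerSeries (Module.End k A)) (n : ℕ) (x y : A) : A :=
  PowerSeries.coeff n F (x * y) -
    ∑ ij ∈ antidiagonal n, PowerSeries.coeff ij.1 F x * PowerSeries.coeff ij.2 F y

theorem sum_antidiagonal_antidiagonal_comm {M : Type*} [AddCommMonoid M] (n : ℕ)
    (f : ℕ → ℕ → ℕ → ℕ → M) :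
    ∑ ij ∈ antidiagonal n, ∑ ab ∈ antidiagonal ij.2, ∑ cd ∈ antidiagonal ij.1,
        f cd.1 cd.2 ab.1 ab.2 =
      ∑ uv ∈ antidiagonal n, ∑ ca ∈ antidiagonal uv.1, ∑ db ∈ antidiagonal uv.2,
        f ca.1 db.1 ca.2 db.2 := by
  simp only [Finset.sum_sigma']
  refine Finset.sum_nbij'
    (fun z => ⟨(z.2.2.1 + z.2.1.1, z.2.2.2 + z.2.1.2), (z.2.2.1, z.2.1.1), (z.2.2.2, z.2.1.2)⟩)
    (fun z => ⟨(z.2.1.1 + z.2.2.1, z.2.1.2 + z.2.2.2), (z.2.1.2, z.2.2.2), (z.2.1.1, z.2.2.1)⟩)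
    ?_ ?_ ?_ ?_ ?_
  · rintro ⟨⟨i, j⟩, ⟨a, b⟩, ⟨c, d⟩⟩ h
    simp only [mem_sigma, mem_antidiagonal, and_true] at h ⊢
    omega
  · rintro ⟨⟨i, j⟩, ⟨a, b⟩, ⟨c, d⟩⟩ h
    simp only [mem_sigma, mem_antidiagonal, and_true] at h ⊢
    omega
  · rintro ⟨⟨i, j⟩, ⟨a, b⟩, ⟨c, d⟩⟩ h
    simp only [mem_sigma, mem_antidiagonal] at h
    obtain ⟨-, rfl, rfl⟩ := h
    rfl
  · rintro ⟨⟨i, j⟩, ⟨a, b⟩, ⟨c, d⟩⟩ h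
    simp only [mem_sigma, mem_antidiagonal] at h
    obtain ⟨-, rfl, rfl⟩ := h
    rfl
  · rintro ⟨⟨i, j⟩, ⟨a, b⟩, ⟨c, d⟩⟩ h
    rfl

theorem leibnizDefect_mul_eq_sum (E F : PowerSeries (Module.End k A)) (n : ℕ) (x y : A) :
    leibnizDefect (E * F) n x y =
      ∑ ij ∈ antidiagonal n, (PowerSeries.coeff ij.1 E (leibnizDefect F ij.2 x y) +
        ∑ ab ∈ antidiagonal ij.2,
          leibnizDefect E ij.1 (PowerSeries.coeff ab.1 F x) (PowerSeries.coeff ab.2 F y)) := by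
  have h := sum_antidiagonal_antidiagonal_comm n (fun c d a b =>
    PowerSeries.coeff c E (PowerSeries.coeff a F x) *
      PowerSeries.coeff d E (PowerSeries.coeff b F y))
  simp only [leibnizDefect, PowerSeries.coeff_mul, LinearMap.sum_apply, Module.End.mul_apply,
    map_sub, map_sum, sum_sub_distrib, Finset.sum_mul_sum, sum_add_distrib] at h ⊢
  rw [← h]
  abel

/-- The defect is additive in the first degree in which it may be nonzero. -/
theorem leibnizDefect_mul {E F : PowerSeries (Module.End k A)} {n : ℕ}
    (hE₀ : PowerSeries.coeff 0 E = 1) (hF₀ : PowerSeries.coeff 0 F = 1)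
    (hE : ∀ i < n, ∀ x y, leibnizDefect E i x y = 0)
    (hF : ∀ i < n, ∀ x y, leibnizDefect F i x y = 0) (x y : A) :
    leibnizDefect (E * F) n x y = leibnizDefect E n x y + leibnizDefect F n x y := by
  rw [leibnizDefect_mul_eq_sum, sum_add_distrib, add_comm]
  congr 1
  · rw [Finset.sum_eq_single (n, 0)]
    · simp [hF₀]
    · rintro ⟨i, j⟩ h hne
      rw [mem_antidiagonal] at h
      have : i < n := by
        rcases Nat.eq_zero_or_pos j with rfl | hj
        · exact absurd (by simpa using h) hne
        · simp only at h; omega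
      exact Finset.sum_eq_zero fun ab _ => hE i this _ _
    · simp
  · rw [Finset.sum_eq_single (0, n)]
    · simp [hE₀]
    · rintro ⟨i, j⟩ h hne
      rw [mem_antidiagonal] at h
      have : j < n := by
        rcases Nat.eq_zero_or_pos i with rfl | hj
        · exact absurd (by simpa using h) hne
        · simp only at h; omega
      simp [hF j this]
    · simp

/-- `F` is, modulo `t^n`, an `I`-logarithmic Hasse-Schmidt derivation: `F_0 = id`, and the
coefficients of index less than `n` satisfy the Leibniz rules and preserve `I`. There is no
condition on the coefficients from index `n` on. -/
structure IsLogHSMod (I : Ideal A) (n : ℕ) (F : PowerSeries (Module.End k A)) : Prop where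
  coeff_zero : PowerSeries.coeff 0 F = 1
  defect : ∀ i < n, ∀ x y, leibnizDefect F i x y = 0
  log : ∀ i < n, ∀ x ∈ I, PowerSeries.coeff i F x ∈ I

variable {I : Ideal A} {n : ℕ}

theorem IsLogHSMod.one : IsLogHSMod I n (1 : PowerSeries (Module.End k A)) where
  coeff_zero := by simp
  defect i _ x y := by
    rcases i with - | i
    · simp [leibnizDefect]
    · rw [leibnizDefect, Finset.sum_eq_zero]
      · simp [PowerSeries.coeff_one]
      · rintro ⟨u, v⟩ h
        rw [mem_antidiagonal] at h
        rcases u with - | u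
        · have : v ≠ 0 := by simp only at h; omega
          simp [PowerSeries.coeff_one, this]
        · simp [PowerSeries.coeff_one]
  log i _ x hx := by
    rw [PowerSeries.coeff_one]
    split_ifs <;> simp [hx]

theorem IsLogHSMod.mul {E F : PowerSeries (Module.End k A)} (hE : IsLogHSMod I n E)
    (hF : IsLogHSMod I n F) : IsLogHSMod I n (E * F) where
  coeff_zero := by simp [PowerSeries.coeff_mul, hE.coeff_zero, hF.coeff_zero]
  defect i hi x y := by
    rw [leibnizDefect_mul hE.coeff_zero hF.coeff_zero
      (fun j hj => hE.defect j (hj.trans hi)) (fun j hj => hF.defect j (hj.trans hi)),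
      hE.defect i hi, hF.defect i hi, add_zero]
  log i hi x hx := by
    rw [PowerSeries.coeff_mul, LinearMap.sum_apply]
    refine I.sum_mem fun uv huv => ?_
    have := mem_antidiagonal.1 huv
    exact hE.log _ (by omega) _ (hF.log _ (by omega) _ hx)

theorem IsLogHSMod.of_mul_left {E F : PowerSeries (Module.End k A)} (hE : IsLogHSMod I n E)
    (hEF : IsLogHSMod I n (E * F)) : IsLogHSMod I n F := by
  have h₀ : PowerSeries.coeff 0 F = 1 := by
    have := hEF.coeff_zero
    rwa [PowerSeries.coeff_mul, Finset.Nat.antidiagonal_zero, sum_singleton, hE.coeff_zero,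
      one_mul] at this
  have key : ∀ i < n, (∀ x y, leibnizDefect F i x y = 0) ∧
      ∀ x ∈ I, PowerSeries.coeff i F x ∈ I := by
    intro i
    induction i using Nat.strong_induction_on with
    | _ i ih =>
      intro hi
      constructor
      · intro x y
        have := leibnizDefect_mul hE.coeff_zero h₀ (n := i)
          (fun j hj => hE.defect j (hj.trans hi)) (fun j hj => (ih j hj (hj.trans hi)).1) x y
        rw [hEF.defect i hi, hE.defect i hi, zero_add] at this
        exact this.symm
      · intro x hx
        have h := hEF.log i hi x hx
        rw [PowerSeries.coeff_mul, LinearMap.sum_apply,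
          ← Finset.add_sum_erase _ _ (show (0, i) ∈ antidiagonal i by simp)] at h
        simp only [hE.coeff_zero, one_mul] at h
        refine (Ideal.add_mem_iff_left I (I.sum_mem fun uv huv => ?_)).1 h
        rw [mem_erase, mem_antidiagonal] at huv
        obtain ⟨u, v⟩ := uv
        have hv : v < i := by
          rcases Nat.eq_zero_or_pos u with rfl | hu
          · exact absurd (by simpa using huv.2) huv.1
          · have := huv.2; simp only at this; omega
        have := huv.2
        exact hE.log _ (by simp only at this ⊢; omega) _ ((ih v hv (hv.trans hi)).2 _ hx)
  exact ⟨h₀, fun i hi => (key i hi).1, fun i hi => (key i hi).2⟩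

theorem IsLogHSMod.mono {F : PowerSeries (Module.End k A)} (hF : IsLogHSMod I n F) {m : ℕ}
    (h : m ≤ n) : IsLogHSMod I m F :=
  ⟨hF.coeff_zero, fun i hi => hF.defect i (hi.trans_le h), fun i hi => hF.log i (hi.trans_le h)⟩

/-- The series `F (t^j)`, for `j ≥ 1`. (Mathlib's substitution of power series needs commutative
coefficients.) -/
noncomputable def expandSeries {R : Type*} [Semiring R] (j : ℕ) (F : PowerSeries R) :
    PowerSeries R :=
  PowerSeries.mk fun n => if j ∣ n then PowerSeries.coeff (n / j) F else 0

theorem coeff_expandSeries_mul {R : Type*} [Semiring R] {j : ℕ} (hj : 0 < j) (F : PowerSeries R)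
    (q : ℕ) : PowerSeries.coeff (j * q) (expandSeries j F) = PowerSeries.coeff q F := by
  simp [expandSeries, Nat.mul_div_cancel_left q hj]

theorem coeff_expandSeries_of_not_dvd {R : Type*} [Semiring R] {j n : ℕ} (h : ¬j ∣ n)
    (F : PowerSeries R) : PowerSeries.coeff n (expandSeries j F) = 0 := by
  simp [expandSeries, h]

theorem leibnizDefect_expandSeries_of_not_dvd {j : ℕ} (h : ¬j ∣ n)
    (F : PowerSeries (Module.End k A)) (x y : A) :
    leibnizDefect (expandSeries j F) n x y = 0 := by
  rw [leibnizDefect, coeff_expandSeries_of_not_dvd h, Finset.sum_eq_zero]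
  · simp
  · rintro ⟨u, v⟩ huv
    rw [mem_antidiagonal] at huv
    by_cases hu : j ∣ u
    · have hv : ¬j ∣ v := fun hv => h (huv ▸ dvd_add hu hv)
      simp [coeff_expandSeries_of_not_dvd hv]
    · simp [coeff_expandSeries_of_not_dvd hu]

theorem leibnizDefect_expandSeries_mul {j : ℕ} (hj : 0 < j) (q : ℕ)
    (F : PowerSeries (Module.End k A)) (x y : A) :
    leibnizDefect (expandSeries j F) (j * q) x y = leibnizDefect F q x y := by
  rw [leibnizDefect, leibnizDefect, coeff_expandSeries_mul hj]
  congr 1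
  symm
  refine Finset.sum_of_injOn (fun uv => (j * uv.1, j * uv.2)) ?_ ?_ ?_ ?_
  · rintro ⟨a, b⟩ - ⟨c, d⟩ - h
    simpa [hj.ne'] using h
  · rintro ⟨a, b⟩ h
    rw [mem_coe, mem_antidiagonal] at h ⊢
    rw [← h, mul_add]
  · rintro ⟨u, v⟩ huv hn
    rw [mem_antidiagonal] at huv
    by_cases hu : j ∣ u
    · obtain ⟨a, rfl⟩ := hu
      obtain ⟨b, rfl⟩ := (Nat.dvd_add_right (Dvd.intro a rfl)).1 (Dvd.intro q huv.symm)
      refine absurd ⟨(a, b), ?_, rfl⟩ hn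
      rw [← mul_add] at huv
      simpa using Nat.eq_of_mul_eq_mul_left hj huv
    · simp [coeff_expandSeries_of_not_dvd hu]
  · rintro ⟨u, v⟩ -
    simp [coeff_expandSeries_mul hj]

theorem IsLogHSMod.expand {F : PowerSeries (Module.End k A)} {m : ℕ}
    (hF : IsLogHSMod I m F) {j : ℕ} (hj : 0 < j) (h : n ≤ j * m) :
    IsLogHSMod I n (expandSeries j F) where
  coeff_zero := by simpa [hF.coeff_zero] using coeff_expandSeries_mul hj F 0
  defect i hi x y := by
    by_cases hd : j ∣ i
    · obtain ⟨q, rfl⟩ := hd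
      rw [leibnizDefect_expandSeries_mul hj]
      exact hF.defect q (lt_of_mul_lt_mul_left (hi.trans_le h) j.zero_le) x y
    · exact leibnizDefect_expandSeries_of_not_dvd hd F x y
  log i hi x hx := by
    by_cases hd : j ∣ i
    · obtain ⟨q, rfl⟩ := hd
      rw [coeff_expandSeries_mul hj]
      exact hF.log q (lt_of_mul_lt_mul_left (hi.trans_le h) j.zero_le) x hx
    · simp [coeff_expandSeries_of_not_dvd hd]

end LeibnizSeries

/-! ### Logarithmic differential operators -/

section DiffOp

variable {k A : Type*} [CommRing k] [CommRing A] [Algebra k A] {I : Ideal A}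

theorem isDiffOpOfOrderLE_zero (n : ℕ) : IsDiffOpOfOrderLE n (0 : Module.End k A) := by
  induction n with
  | zero => intro b; simp
  | succ n ih => intro b; simpa using ih

theorem IsDiffOpOfOrderLE.succ {n : ℕ} {P : Module.End k A} (hP : IsDiffOpOfOrderLE n P) :
    IsDiffOpOfOrderLE (n + 1) P := by
  induction n generalizing P with
  | zero => intro b; rw [hP b]; exact isDiffOpOfOrderLE_zero 0
  | succ n ih => intro b; exact ih (hP b)

theorem IsDiffOpOfOrderLE.mono {m n : ℕ} {P : Module.End k A} (hP : IsDiffOpOfOrderLE m P)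
    (h : m ≤ n) : IsDiffOpOfOrderLE n P := by
  induction n, h using Nat.le_induction with
  | base => exact hP
  | succ n _ ih => exact ih.succ

theorem IsDiffOpOfOrderLE.sub {n : ℕ} {P Q : Module.End k A} (hP : IsDiffOpOfOrderLE n P)
    (hQ : IsDiffOpOfOrderLE n Q) : IsDiffOpOfOrderLE n (P - Q) := by
  induction n generalizing P Q with
  | zero =>
    intro b
    rw [sub_mul, mul_sub, sub_sub_sub_comm, hP b, hQ b, sub_zero]
  | succ n ih =>
    intro b
    rw [sub_mul, mul_sub, sub_sub_sub_comm]
    exact ih (hP b) (hQ b)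

theorem IsDiffOpOfOrderLE.add {n : ℕ} {P Q : Module.End k A} (hP : IsDiffOpOfOrderLE n P)
    (hQ : IsDiffOpOfOrderLE n Q) : IsDiffOpOfOrderLE n (P + Q) := by
  simpa using hP.sub ((isDiffOpOfOrderLE_zero n).sub hQ)

theorem IsDiffOpOfOrderLE.sum {n : ℕ} {ι : Type*} {t : Finset ι} {P : ι → Module.End k A}
    (hP : ∀ i ∈ t, IsDiffOpOfOrderLE n (P i)) : IsDiffOpOfOrderLE n (∑ i ∈ t, P i) :=
  Finset.sum_induction _ _ (fun _ _ => IsDiffOpOfOrderLE.add) (isDiffOpOfOrderLE_zero n) hP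

theorem isDiffOpOfOrderLE_mulLeft (c : A) : IsDiffOpOfOrderLE 0 (LinearMap.mulLeft k c) := by
  intro b
  ext x
  simp [mul_left_comm]

theorem IsDiffOpOfOrderLE.mul {m n : ℕ} {P Q : Module.End k A} (hP : IsDiffOpOfOrderLE m P)
    (hQ : IsDiffOpOfOrderLE n Q) : IsDiffOpOfOrderLE (m + n) (P * Q) := by
  have comm_mul : ∀ (P Q B : Module.End k A),
      P * Q * B - B * (P * Q) = P * (Q * B - B * Q) + (P * B - B * P) * Q := by
    intro P Q B
    simp only [mul_sub, sub_mul, mul_assoc]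
    abel
  induction h : m + n generalizing m n P Q with
  | zero =>
    obtain ⟨rfl, rfl⟩ : m = 0 ∧ n = 0 := by omega
    intro b
    rw [comm_mul, hP b, hQ b, mul_zero, zero_mul, add_zero]
  | succ N ih =>
    intro b
    rw [comm_mul]
    refine IsDiffOpOfOrderLE.add ?_ ?_
    · rcases n with - | n
      · rw [hQ b, mul_zero]; exact isDiffOpOfOrderLE_zero N
      · exact ih hP (hQ b) (by omega)
    · rcases m with - | m
      · rw [hP b, zero_mul]; exact isDiffOpOfOrderLE_zero N
      · exact ih (hP b) hQ (by omega)

theorem IsLogDiffOp.zero : IsLogDiffOp I (0 : Module.End k A) :=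
  ⟨⟨0, isDiffOpOfOrderLE_zero 0⟩, by simp⟩

theorem IsLogDiffOp.add {P Q : Module.End k A} (hP : IsLogDiffOp I P) (hQ : IsLogDiffOp I Q) :
    IsLogDiffOp I (P + Q) := by
  obtain ⟨⟨m, hm⟩, hP⟩ := hP
  obtain ⟨⟨n, hn⟩, hQ⟩ := hQ
  exact ⟨⟨m + n, (hm.mono (by omega)).add (hn.mono (by omega))⟩,
    fun x hx => I.add_mem (hP x hx) (hQ x hx)⟩

theorem IsLogDiffOp.sub {P Q : Module.End k A} (hP : IsLogDiffOp I P) (hQ : IsLogDiffOp I Q) :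
    IsLogDiffOp I (P - Q) := by
  obtain ⟨⟨m, hm⟩, hP⟩ := hP
  obtain ⟨⟨n, hn⟩, hQ⟩ := hQ
  exact ⟨⟨m + n, (hm.mono (by omega)).sub (hn.mono (by omega))⟩,
    fun x hx => I.sub_mem (hP x hx) (hQ x hx)⟩

theorem IsLogDiffOp.mul {P Q : Module.End k A} (hP : IsLogDiffOp I P) (hQ : IsLogDiffOp I Q) :
    IsLogDiffOp I (P * Q) := by
  obtain ⟨⟨m, hm⟩, hP⟩ := hP
  obtain ⟨⟨n, hn⟩, hQ⟩ := hQ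
  exact ⟨⟨m + n, hm.mul hn⟩, fun x hx => hP _ (hQ x hx)⟩

/-- The Leibniz rule of order `i` writes the commutator of `F_i` with the multiplication by `b` as
`∑ F_u (b) F_v` over `u + v = i`, `u ≥ 1`. -/
theorem isDiffOpOfOrderLE_coeff {F : PowerSeries (Module.End k A)} {n : ℕ}
    (hF₀ : PowerSeries.coeff 0 F = 1) (hF : ∀ i < n, ∀ x y, leibnizDefect F i x y = 0)
    {i : ℕ} (hi : i < n) : IsDiffOpOfOrderLE i (PowerSeries.coeff i F) := by
  induction i using Nat.strong_induction_on with
  | _ i ih =>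
    rcases i with - | i
    · rw [hF₀]
      intro b
      simp
    · intro b
      have : PowerSeries.coeff (i + 1) F * LinearMap.mulLeft k b -
          LinearMap.mulLeft k b * PowerSeries.coeff (i + 1) F =
          ∑ uv ∈ antidiagonal i,
            LinearMap.mulLeft k (PowerSeries.coeff (uv.1 + 1) F b) * PowerSeries.coeff uv.2 F := by
        ext x
        have := hF (i + 1) hi b x
        rw [leibnizDefect, Finset.Nat.sum_antidiagonal_succ, sub_eq_zero] at this
        simp [this, hF₀, LinearMap.sum_apply]
      rw [this]
      refine IsDiffOpOfOrderLE.sum fun uv huv => ?_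
      have := mem_antidiagonal.1 huv
      have h := (isDiffOpOfOrderLE_mulLeft (k := k) (PowerSeries.coeff (uv.1 + 1) F b)).mul
        (ih uv.2 (by omega) (by omega))
      exact h.mono (by omega)

theorem IsLogHSMod.isLogDiffOp_coeff {F : PowerSeries (Module.End k A)} {n : ℕ}
    (hF : IsLogHSMod I n F) {i : ℕ} (hi : i < n) : IsLogDiffOp I (PowerSeries.coeff i F) :=
  ⟨⟨i, isDiffOpOfOrderLE_coeff hF.coeff_zero hF.defect hi⟩, hF.log i hi⟩

theorem IsLogHSMod.isLogDiffOp_coeff_mul {E F : PowerSeries (Module.End k A)} {n : ℕ}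
    (hE : IsLogHSMod I n E) (hF : IsLogHSMod I n F)
    (hEn : IsLogDiffOp I (PowerSeries.coeff n E)) (hFn : IsLogDiffOp I (PowerSeries.coeff n F)) :
    IsLogDiffOp I (PowerSeries.coeff n (E * F)) := by
  have aux : ∀ {G : PowerSeries (Module.End k A)}, IsLogHSMod I n G →
      IsLogDiffOp I (PowerSeries.coeff n G) → ∀ i ≤ n, IsLogDiffOp I (PowerSeries.coeff i G) := by
    intro G hG hGn i hi
    rcases hi.lt_or_eq with h | rfl
    exacts [hG.isLogDiffOp_coeff h, hGn]
  rw [PowerSeries.coeff_mul]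
  refine Finset.sum_induction _ _ (fun _ _ => IsLogDiffOp.add) IsLogDiffOp.zero fun uv huv => ?_
  have := mem_antidiagonal.1 huv
  exact (aux hE hEn _ (by omega)).mul (aux hF hFn _ (by omega))

end DiffOp

/-! ### Series and integrals of derivations -/

section Integrals

variable {k A : Type*} [CommRing k] [CommRing A] [Algebra k A] {I : Ideal A}

theorem HSDer.leibnizDefect_mk {m : ℕ} (D : HSDer k A m) {n : ℕ} (hn : n ≤ m) (x y : A) :
    leibnizDefect (PowerSeries.mk D.comp) n x y = 0 := by
  simp [leibnizDefect, D.comp_mul n hn]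

theorem HSDer.isLogHSMod_mk {m n : ℕ} (D : HSDer k A m) (hn : n ≤ m + 1)
    (hD : ∀ i < n, ∀ x ∈ I, D.comp i x ∈ I) : IsLogHSMod I n (PowerSeries.mk D.comp) where
  coeff_zero := by rw [PowerSeries.coeff_mk, D.comp_zero]; rfl
  defect i hi := D.leibnizDefect_mk (by omega)
  log i hi x hx := by rw [PowerSeries.coeff_mk]; exact hD i hi x hx

/-- The Hasse-Schmidt derivation of length `m` whose components are the coefficients of index at
most `m` of a series. -/
noncomputable def HSDer.ofSeries (m : ℕ) (F : PowerSeries (Module.End k A))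
    (h₀ : PowerSeries.coeff 0 F = 1) (hF : ∀ i ≤ m, ∀ x y, leibnizDefect F i x y = 0) :
    HSDer k A m where
  comp i := if i ≤ m then PowerSeries.coeff i F else 0
  comp_zero := by rw [if_pos m.zero_le, h₀]; rfl
  comp_mul n hn x y := by
    rw [if_pos hn, sub_eq_zero.1 (hF n hn x y)]
    refine Finset.sum_congr rfl fun uv huv => ?_
    have := mem_antidiagonal.1 huv
    rw [if_pos (by omega), if_pos (by omega)]
  comp_of_lt n hn := by rw [if_neg (by omega)]

theorem HSDer.ofSeries_comp {m : ℕ} {F : PowerSeries (Module.End k A)}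
    (h₀ : PowerSeries.coeff 0 F = 1) (hF : ∀ i ≤ m, ∀ x y, leibnizDefect F i x y = 0)
    {i : ℕ} (hi : i ≤ m) : (HSDer.ofSeries m F h₀ hF).comp i = PowerSeries.coeff i F :=
  if_pos hi

theorem HSDer.le_ell_iff {m : ℕ} (D : HSDer k A m) (e : ℕ) :
    (e : ℕ∞) ≤ D.ell ↔ ∀ h, 1 ≤ h → h < e → D.comp h = 0 := by
  simp only [HSDer.ell, le_iInf_iff, Nat.cast_le]
  refine forall_congr' fun h => ?_
  constructor
  · intro H h1 he
    by_contra hne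
    exact absurd (H ⟨h1, hne⟩) (by omega)
  · rintro H ⟨h1, hne⟩
    by_contra he
    exact hne (H h1 (by omega))

/-- The coefficient of index `1` of an `I`-logarithmic Hasse-Schmidt derivation of length `m`,
given as a series modulo `t^(m+1)`, is an `I`-logarithmically `m`-integrable derivation. -/
theorem IsLogHSMod.exists_logIDer {m : ℕ} (hm : 1 ≤ m) {F : PowerSeries (Module.End k A)}
    (hF : IsLogHSMod I (m + 1) F) :
    ∃ δ ∈ LogIDer k I m, (δ : A →ₗ[k] A) = PowerSeries.coeff 1 F := by
  refine ⟨Derivation.mk' (PowerSeries.coeff 1 F) fun x y => ?_, ?_, rfl⟩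
  · have := hF.defect 1 (by omega) x y
    rw [leibnizDefect, Finset.Nat.sum_antidiagonal_succ, Finset.Nat.antidiagonal_zero,
      sum_singleton, hF.coeff_zero, sub_eq_zero] at this
    simpa [mul_comm y, hF.coeff_zero] using this
  · have hd : ∀ i ≤ m, ∀ x y, leibnizDefect F i x y = 0 := fun i hi => hF.defect i (by omega)
    refine ⟨HSDer.ofSeries m F hF.coeff_zero hd, fun i hi x hx => ?_, hm, ?_⟩
    · rw [HSDer.ofSeries_comp _ _ hi]
      exact hF.log i (by omega) x hx
    · rw [HSDer.ofSeries_comp _ _ hm]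
      rfl

/-- The components of an integral `D` of length `m` vanish beyond `m`, so all coefficients of the
series `∑ D_i t^i` are logarithmic differential operators, including those beyond the range where
the Leibniz rules hold. -/
theorem exists_series_of_mem_logIDer {m : ℕ} {δ : Derivation k A A} (h : δ ∈ LogIDer k I m) :
    ∃ E : PowerSeries (Module.End k A), IsLogHSMod I (m + 1) E ∧
      PowerSeries.coeff 1 E = (δ : A →ₗ[k] A) ∧ ∀ i, IsLogDiffOp I (PowerSeries.coeff i E) := by
  obtain ⟨D, hlog, -, h1⟩ := h
  have hE : IsLogHSMod I (m + 1) (PowerSeries.mk D.comp) :=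
    D.isLogHSMod_mk le_rfl fun i hi => hlog i (by omega)
  refine ⟨_, hE, by rw [PowerSeries.coeff_mk, h1], fun i => ?_⟩
  rcases Nat.lt_or_ge i (m + 1) with hi | hi
  · exact hE.isLogDiffOp_coeff hi
  · rw [PowerSeries.coeff_mk, D.comp_of_lt i hi]
    exact IsLogDiffOp.zero

/-- Without leaps strictly between two consecutive powers of `p`, an integral of length `p^σ` can
be exchanged for one of any length below `p^(σ+1)`. -/
theorem NoLogLeapsBelow.mem_logIDer {p a : ℕ} (hA : NoLogLeapsBelow k I p a) (hp : 2 ≤ p)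
    {σ : ℕ} (hσ : σ + 1 ≤ a) {δ : Derivation k A A} (hδ : δ ∈ LogIDer k I (p ^ σ)) {m : ℕ}
    (hm : p ^ σ ≤ m) (hm' : m < p ^ (σ + 1)) : δ ∈ LogIDer k I m := by
  induction m, hm using Nat.le_induction with
  | base => exact hδ
  | succ m hm ih =>
    have hpos : 0 < p ^ σ := by positivity
    have hle : p ^ (σ + 1) ≤ p ^ a := Nat.pow_le_pow_right (by omega) hσ
    rw [← hA (m + 1) (by omega) (by omega)]
    · exact ih (by omega)
    · rintro j hj
      have h1 : p ^ σ < p ^ j := by omega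
      have h2 : p ^ j < p ^ (σ + 1) := by omega
      have h1' := (Nat.pow_lt_pow_iff_right (by omega)).1 h1
      have h2' := (Nat.pow_lt_pow_iff_right (by omega)).1 h2
      omega

end Integrals

/-! ### Factorization into series in powers of the variable -/

section Factorization

variable {k A : Type*} [CommRing k] [CommRing A] [Algebra k A] {I : Ideal A}

theorem coeff_mul_of_coeff_eq_zero {R : Type*} [Semiring R] {j i : ℕ} {G F : PowerSeries R}
    (hG₀ : PowerSeries.coeff 0 G = 1) (hG : ∀ u, 0 < u → u < j → PowerSeries.coeff u G = 0)
    (hi : i < j) : PowerSeries.coeff i (G * F) = PowerSeries.coeff i F := by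
  rw [PowerSeries.coeff_mul, Finset.sum_eq_single (0, i)]
  · rw [hG₀, one_mul]
  · rintro ⟨u, v⟩ h hne
    rw [mem_antidiagonal] at h
    rcases Nat.eq_zero_or_pos u with rfl | hu
    · exact absurd (by simpa using h) hne
    · rw [hG u hu (by simp only at h; omega), zero_mul]
  · simp

theorem coeff_mul_eq_add {R : Type*} [Semiring R] {n : ℕ} (hn : 0 < n)
    {G F : PowerSeries R} (hG₀ : PowerSeries.coeff 0 G = 1) (hF₀ : PowerSeries.coeff 0 F = 1)
    (h : ∀ u v, 0 < u → 0 < v → u + v = n →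
      PowerSeries.coeff u G * PowerSeries.coeff v F = 0) :
    PowerSeries.coeff n (G * F) = PowerSeries.coeff n G + PowerSeries.coeff n F := by
  rw [PowerSeries.coeff_mul, Finset.sum_eq_add (n, 0) (0, n)]
  · rw [hG₀, hF₀, one_mul, mul_one]
  · simp [hn.ne]
  · rintro ⟨u, v⟩ huv hne
    rw [mem_antidiagonal] at huv
    simp only [ne_eq, Prod.mk.injEq, not_and] at hne huv
    exact h u v (by omega) (by omega) huv
  · simp
  · simp

theorem coeff_expandSeries_eq_zero {R : Type*} [Semiring R] {j u : ℕ} (F : PowerSeries R)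
    (hu : 0 < u) (huj : u < j) : PowerSeries.coeff u (expandSeries j F) = 0 :=
  coeff_expandSeries_of_not_dvd (Nat.not_dvd_of_pos_of_lt hu huj) F

/-- Splitting off a factor `E (t^j)` that carries the first nonzero coefficient, of index `j`. -/
theorem IsLogHSMod.exists_expandSeries_mul {j n m : ℕ} (hj : 0 < j)
    {F E : PowerSeries (Module.End k A)} (hF : IsLogHSMod I n F)
    (hFj : ∀ i, 0 < i → i < j → PowerSeries.coeff i F = 0) (hE : IsLogHSMod I m E)
    (hnm : n ≤ j * m) (h : PowerSeries.coeff 1 E = PowerSeries.coeff j F) :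
    ∃ F', F = expandSeries j E * F' ∧ IsLogHSMod I n F' ∧
      ∀ i, 0 < i → i < j + 1 → PowerSeries.coeff i F' = 0 := by
  have hG : IsLogHSMod I n (expandSeries j E) := hE.expand hj hnm
  have hGj : ∀ u, 0 < u → u < j → PowerSeries.coeff u (expandSeries j E) = 0 :=
    fun u => coeff_expandSeries_eq_zero E
  obtain ⟨F', rfl⟩ : ∃ F', F = expandSeries j E * F' := by
    refine ⟨PowerSeries.invOfUnit (expandSeries j E) 1 * F, ?_⟩
    rw [← mul_assoc, PowerSeries.mul_invOfUnit, one_mul]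
    rw [← PowerSeries.coeff_zero_eq_constantCoeff_apply, hG.coeff_zero, Units.val_one]
  have hF' := hG.of_mul_left hF
  refine ⟨F', rfl, hF', fun i hi hij => ?_⟩
  rcases Nat.lt_succ_iff_lt_or_eq.1 hij with hij | rfl
  · rw [← hFj i hi hij, coeff_mul_of_coeff_eq_zero hG.coeff_zero hGj hij]
  · rw [coeff_mul_eq_add hi hG.coeff_zero hF'.coeff_zero
      fun u v hu hv huv => by rw [hGj u hu (by omega), zero_mul]] at h
    have h1 := coeff_expandSeries_mul hi E 1
    rw [mul_one] at h1
    rw [h1] at h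
    exact left_eq_add.1 h

/-- Every series `F = 1 + F_e t^e + ⋯` which is a Hasse-Schmidt derivation modulo `t^(e p^s + 1)`
and `I`-logarithmic modulo `t^(e p^s)` gives rise to a `p^s`-integral of `F_e` that is
`I`-logarithmic modulo `t^(p^s)` and whose last component differs from `F_{e p^s}` by a logarithmic
differential operator. Here `e ≥ 1` is arbitrary and `s` is fixed, as needed for an induction on
`s`. -/
def HasPowIntegrals (k : Type*) {A : Type*} [CommRing k] [CommRing A] [Algebra k A]
    (I : Ideal A) (p s : ℕ) : Prop :=
  ∀ e, 1 ≤ e → ∀ F : PowerSeries (Module.End k A), IsLogHSMod I (e * p ^ s) F →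
    (∀ x y, leibnizDefect F (e * p ^ s) x y = 0) →
    (∀ i, 0 < i → i < e → PowerSeries.coeff i F = 0) →
    ∃ G : PowerSeries (Module.End k A), IsLogHSMod I (p ^ s) G ∧
      (∀ x y, leibnizDefect G (p ^ s) x y = 0) ∧
      PowerSeries.coeff 1 G = PowerSeries.coeff e F ∧
      ∃ H, IsLogDiffOp I H ∧
        PowerSeries.coeff (p ^ s) G = PowerSeries.coeff (e * p ^ s) F + H

/-- The leading coefficient `F_j` has an `I`-logarithmic integral that is long enough to be
substituted at `t^j` modulo `t^n` whenever `j p^σ < n ≤ j p^(σ+1)`: since `j p^σ < n`, the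
`p^σ`-integral of `F_j` is logarithmic in its last component too, and the absence of leaps
prolongs it to length `p^(σ+1) - 1`. -/
theorem IsLogHSMod.exists_integral {p a σ : ℕ} (hp : 2 ≤ p) (hA : NoLogLeapsBelow k I p a)
    (hσ : σ + 1 ≤ a) (ih : HasPowIntegrals k I p σ) {j n : ℕ} (hj : 1 ≤ j) (hjn : j * p ^ σ < n)
    {F : PowerSeries (Module.End k A)} (hF : IsLogHSMod I n F)
    (hFj : ∀ i, 0 < i → i < j → PowerSeries.coeff i F = 0) :
    ∃ E : PowerSeries (Module.End k A), IsLogHSMod I (p ^ (σ + 1)) E ∧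
      PowerSeries.coeff 1 E = PowerSeries.coeff j F ∧
      ∀ i, IsLogDiffOp I (PowerSeries.coeff i E) := by
  obtain ⟨G, hG, hGd, hG1, H, hH, hGH⟩ :=
    ih j hj F (hF.mono hjn.le) (hF.defect _ hjn) hFj
  have hG' : IsLogHSMod I (p ^ σ + 1) G := by
    refine ⟨hG.coeff_zero, fun i hi => ?_, fun i hi => ?_⟩
    · rcases Nat.lt_succ_iff_lt_or_eq.1 hi with hi | rfl
      exacts [hG.defect i hi, hGd]
    · rcases Nat.lt_succ_iff_lt_or_eq.1 hi with hi | rfl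
      · exact hG.log i hi
      · intro x hx
        rw [hGH]
        exact I.add_mem (hF.log _ hjn x hx) (hH.2 x hx)
  obtain ⟨δ, hδ, hδ1⟩ := hG'.exists_logIDer (Nat.one_le_pow _ _ (by omega))
  have hlt : p ^ σ < p ^ (σ + 1) := Nat.pow_lt_pow_right (by omega) (by omega)
  obtain ⟨E, hE, hE1, hEl⟩ := exists_series_of_mem_logIDer
    (hA.mem_logIDer hp hσ hδ (m := p ^ (σ + 1) - 1) (by omega) (by omega))
  rw [Nat.sub_add_cancel (by omega)] at hE
  exact ⟨E, hE, by rw [hE1, hδ1, hG1], hEl⟩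

/-- The factor `E (t^j)` of a series modulo `t^(e p^s)` has a counterpart `R` modulo `t^(p^s)` with
the same defect in the critical degree. If `j = e p^i` with `i < s`, it is `E (t^(p^i))`, both
defects being that of `E` in degree `p^(s-i)`. For any other `j` the defect of `E (t^j)` in degree
`e p^s` vanishes, because it is zero or a defect of `E` in degree less than `p^(σ+1)`, and `R = 1`
will do. -/
theorem exists_counterpart {p s e j σ : ℕ} (hp : 2 ≤ p) (he : 1 ≤ e) (hej : e ≤ j)
    (hσ : σ < s) (hjσ : e * p ^ s ≤ j * p ^ (σ + 1)) {E : PowerSeries (Module.End k A)}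
    (hE : IsLogHSMod I (p ^ (σ + 1)) E) (hEl : ∀ i, IsLogDiffOp I (PowerSeries.coeff i E)) :
    ∃ R : PowerSeries (Module.End k A), IsLogHSMod I (p ^ s) R ∧
      IsLogDiffOp I (PowerSeries.coeff (p ^ s) R) ∧
      (∀ x y, leibnizDefect (expandSeries j E) (e * p ^ s) x y = leibnizDefect R (p ^ s) x y) ∧
      PowerSeries.coeff 1 R = if j = e then PowerSeries.coeff 1 E else 0 := by
  have hps : ∀ i, 0 < p ^ i := fun i => by positivity
  by_cases hex : ∃ i < s, j = e * p ^ i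
  · obtain ⟨i, hi, rfl⟩ := hex
    have hsplit : p ^ s = p ^ i * p ^ (s - i) := by rw [← pow_add]; congr 1; omega
    refine ⟨expandSeries (p ^ i) E, hE.expand (hps i) ?_, ?_, fun x y => ?_, ?_⟩
    · rw [mul_assoc] at hjσ
      exact Nat.le_of_mul_le_mul_left hjσ he
    · rw [hsplit, coeff_expandSeries_mul (hps i)]
      exact hEl _
    · rw [hsplit, ← mul_assoc, leibnizDefect_expandSeries_mul (Nat.mul_pos he (hps i)),
        leibnizDefect_expandSeries_mul (hps i)]
    · rcases Nat.eq_zero_or_pos i with rfl | hi0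
      · have := coeff_expandSeries_mul one_pos E 1
        simpa using this
      · have h1 : 1 < p ^ i := Nat.one_lt_pow hi0.ne' (by omega)
        have hne : e * p ^ i ≠ e := by nlinarith
        rw [if_neg hne, coeff_expandSeries_eq_zero E one_pos h1]
  · have hne : j ≠ e := by
      rintro rfl
      exact hex ⟨0, by omega, by simp⟩
    refine ⟨1, IsLogHSMod.one, ?_, fun x y => ?_, ?_⟩
    · exact (IsLogHSMod.one (n := p ^ s + 1)).isLogDiffOp_coeff (by omega)
    · rw [(IsLogHSMod.one (I := I) (n := p ^ s + 1)).defect _ (by omega)]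
      by_cases hd : j ∣ e * p ^ s
      · obtain ⟨q, hq⟩ := hd
        rw [hq, leibnizDefect_expandSeries_mul (by omega)]
        rw [hq] at hjσ
        refine hE.defect q (lt_of_le_of_ne (Nat.le_of_mul_le_mul_left hjσ (by omega)) ?_) x y
        rintro rfl
        refine hex ⟨s - (σ + 1), by omega, ?_⟩
        have hsplit : p ^ s = p ^ (s - (σ + 1)) * p ^ (σ + 1) := by
          rw [← pow_add]; congr 1; omega
        rw [hsplit, ← mul_assoc] at hq
        exact (Nat.eq_of_mul_eq_mul_right (hps _) hq).symm
      · exact leibnizDefect_expandSeries_of_not_dvd hd E x y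
    · simp [PowerSeries.coeff_one, hne]

/-- The factors `E (t^i)` with `e ≤ i < j` are split off from `D` one after the other: `P` is their
product, `F` the remaining factor, which starts in degree `j`, and `Q` the product of the
counterparts of the factors. -/
theorem exists_factorization {p a s e : ℕ} (hp : 2 ≤ p) (hA : NoLogLeapsBelow k I p a)
    (hsa : s ≤ a) (he : 1 ≤ e) (ih : ∀ σ < s, HasPowIntegrals k I p σ)
    {D : PowerSeries (Module.End k A)} (hD : IsLogHSMod I (e * p ^ s) D)
    (hDe : ∀ i, 0 < i → i < e → PowerSeries.coeff i D = 0) {j : ℕ} (hej : e ≤ j)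
    (hjN : j ≤ e * p ^ s) :
    ∃ P F Q : PowerSeries (Module.End k A), D = P * F ∧
      IsLogHSMod I (e * p ^ s) P ∧ IsLogHSMod I (e * p ^ s) F ∧ IsLogHSMod I (p ^ s) Q ∧
      (∀ i, 0 < i → i < j → PowerSeries.coeff i F = 0) ∧
      IsLogDiffOp I (PowerSeries.coeff (e * p ^ s) P) ∧
      IsLogDiffOp I (PowerSeries.coeff (p ^ s) Q) ∧
      (∀ x y, leibnizDefect P (e * p ^ s) x y = leibnizDefect Q (p ^ s) x y) ∧
      PowerSeries.coeff e D = PowerSeries.coeff 1 Q + PowerSeries.coeff e F := by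
  induction j, hej using Nat.le_induction with
  | base =>
    refine ⟨1, D, 1, (one_mul D).symm, .one, hD, .one, hDe, ?_, ?_, fun x y => ?_, ?_⟩
    · exact (IsLogHSMod.one (n := e * p ^ s + 1)).isLogDiffOp_coeff (by omega)
    · exact (IsLogHSMod.one (n := p ^ s + 1)).isLogDiffOp_coeff (by omega)
    · rw [(IsLogHSMod.one (I := I) (n := e * p ^ s + 1)).defect _ (by omega),
        (IsLogHSMod.one (I := I) (n := p ^ s + 1)).defect _ (by omega)]
    · simp [PowerSeries.coeff_one]
  | succ j hej IH =>
    obtain ⟨P, F, Q, hDPF, hP, hF, hQ, hFj, hPN, hQN, hPQ, hQ1⟩ := IH (by omega)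
    have hj : 0 < j := by omega
    -- `σ + 1` is the least `τ` with `e p^s ≤ j p^τ`; it is positive since `j < e p^s`
    obtain ⟨σ, hσs, hσ1, hσ2⟩ : ∃ σ < s, j * p ^ σ < e * p ^ s ∧ e * p ^ s ≤ j * p ^ (σ + 1) := by
      have hex : ∃ τ, e * p ^ s ≤ j * p ^ τ := ⟨s, Nat.mul_le_mul_right _ hej⟩
      have hmin := Nat.find_min' hex (Nat.mul_le_mul_right (p ^ s) hej)
      have hspec := Nat.find_spec hex
      rcases hτ : Nat.find hex with - | τ
      · rw [hτ] at hspec; simp at hspec; omega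
      · rw [hτ] at hspec hmin
        exact ⟨τ, by omega, not_le.1 (Nat.find_min hex (by omega)), hspec⟩
    obtain ⟨E, hE, hE1, hEl⟩ := hF.exists_integral hp hA (by omega) (ih σ hσs) hj hσ1 hFj
    obtain ⟨F', hFF', hF', hF'j⟩ := hF.exists_expandSeries_mul hj hFj hE hσ2 hE1
    obtain ⟨R, hR, hRs, hRd, hR1⟩ := exists_counterpart hp he hej hσs hσ2 hE hEl
    have hG : IsLogHSMod I (e * p ^ s) (expandSeries j E) := hE.expand hj hσ2
    have hGN : IsLogDiffOp I (PowerSeries.coeff (e * p ^ s) (expandSeries j E)) := by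
      by_cases hd : j ∣ e * p ^ s
      · obtain ⟨q, hq⟩ := hd
        rw [hq, coeff_expandSeries_mul hj]
        exact hEl q
      · rw [coeff_expandSeries_of_not_dvd hd]
        exact .zero
    refine ⟨P * expandSeries j E, F', Q * R, by rw [mul_assoc, ← hFF', hDPF], hP.mul hG, hF',
      hQ.mul hR, hF'j, hP.isLogDiffOp_coeff_mul hG hPN hGN, hQ.isLogDiffOp_coeff_mul hR hQN hRs,
      fun x y => ?_, ?_⟩
    · rw [leibnizDefect_mul hP.coeff_zero hG.coeff_zero hP.defect hG.defect,
        leibnizDefect_mul hQ.coeff_zero hR.coeff_zero hQ.defect hR.defect, hPQ, hRd]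
    · have hQR : PowerSeries.coeff 1 (Q * R) = PowerSeries.coeff 1 Q + PowerSeries.coeff 1 R := by
        exact coeff_mul_eq_add one_pos hQ.coeff_zero hR.coeff_zero fun u v hu hv h => by omega
      rw [hQR, hQ1, hR1, hF'j e (by omega) (by omega), add_zero]
      rcases hej.eq_or_lt with rfl | hlt
      · rw [if_pos rfl, hE1]
      · rw [if_neg hlt.ne', hFj e (by omega) hlt]

theorem leibnizDefect_of_coeff_eq_zero {F : PowerSeries (Module.End k A)} {n : ℕ} (hn : 0 < n)
    (hF₀ : PowerSeries.coeff 0 F = 1) (hF : ∀ i, 0 < i → i < n → PowerSeries.coeff i F = 0)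
    (x y : A) : leibnizDefect F n x y =
      PowerSeries.coeff n F (x * y) -
        (x * PowerSeries.coeff n F y + PowerSeries.coeff n F x * y) := by
  rw [leibnizDefect, Finset.sum_eq_add (0, n) (n, 0)]
  · simp [hF₀]
  · simp [hn.ne]
  · rintro ⟨u, v⟩ h hne
    rw [mem_antidiagonal] at h
    simp only [ne_eq, Prod.mk.injEq, not_and] at hne h
    simp [hF u (by omega) (by omega)]
  · simp
  · simp

theorem coeff_add_monomial_of_lt {R : Type*} [Semiring R] {n i : ℕ} (hi : i < n)
    (F : PowerSeries R) (X : R) :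
    PowerSeries.coeff i (F + PowerSeries.monomial n X) = PowerSeries.coeff i F := by
  rw [map_add, PowerSeries.coeff_monomial, if_neg hi.ne, add_zero]

theorem leibnizDefect_congr {F G : PowerSeries (Module.End k A)} {n : ℕ}
    (h : ∀ i ≤ n, PowerSeries.coeff i F = PowerSeries.coeff i G) (x y : A) :
    leibnizDefect F n x y = leibnizDefect G n x y := by
  rw [leibnizDefect, leibnizDefect, h n le_rfl]
  congr 1
  refine Finset.sum_congr rfl fun uv huv => ?_
  have := mem_antidiagonal.1 huv
  rw [h _ (by omega), h _ (by omega)]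

theorem IsLogHSMod.add_monomial {n : ℕ} (hn : 0 < n) {F : PowerSeries (Module.End k A)}
    (hF : IsLogHSMod I n F) (X : Module.End k A) :
    IsLogHSMod I n (F + PowerSeries.monomial n X) where
  coeff_zero := by rw [coeff_add_monomial_of_lt hn, hF.coeff_zero]
  defect i hi x y := by
    rw [leibnizDefect_congr (G := F) fun j hj => coeff_add_monomial_of_lt (hj.trans_lt hi) F X,
      hF.defect i hi]
  log i hi x hx := by
    rw [coeff_add_monomial_of_lt hi]
    exact hF.log i hi x hx

theorem leibnizDefect_add_monomial {n : ℕ} (hn : 0 < n) {F : PowerSeries (Module.End k A)}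
    (hF₀ : PowerSeries.coeff 0 F = 1) (X : Module.End k A) (x y : A) :
    leibnizDefect (F + PowerSeries.monomial n X) n x y =
      leibnizDefect F n x y + (X (x * y) - (x * X y + X x * y)) := by
  have hsum : ∑ uv ∈ antidiagonal n,
      (PowerSeries.coeff uv.1 (F + PowerSeries.monomial n X) x *
        PowerSeries.coeff uv.2 (F + PowerSeries.monomial n X) y -
        PowerSeries.coeff uv.1 F x * PowerSeries.coeff uv.2 F y) = x * X y + X x * y := by
    rw [Finset.sum_eq_add (0, n) (n, 0)]
    · simp only [coeff_add_monomial_of_lt hn, hF₀, map_add, PowerSeries.coeff_monomial, if_true,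
        LinearMap.add_apply, Module.End.one_apply]
      ring
    · simp [hn.ne]
    · rintro ⟨u, v⟩ huv hne
      rw [mem_antidiagonal] at huv
      simp only [ne_eq, Prod.mk.injEq, not_and] at hne huv
      rw [coeff_add_monomial_of_lt (by omega), coeff_add_monomial_of_lt (by omega), sub_self]
    · simp
    · simp
  rw [sum_sub_distrib, sub_eq_iff_eq_add] at hsum
  rw [leibnizDefect, leibnizDefect, hsum, map_add, PowerSeries.coeff_monomial, if_pos rfl,
    LinearMap.add_apply]
  abel

theorem hasPowIntegrals {p a : ℕ} (hp : 2 ≤ p) (hA : NoLogLeapsBelow k I p a) {s : ℕ}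
    (hsa : s ≤ a) : HasPowIntegrals k I p s := by
  induction s using Nat.strong_induction_on with
  | _ s ih =>
    intro e he D hD hDN hDe
    have hps : 0 < p ^ s := by positivity
    have hN : 0 < e * p ^ s := Nat.mul_pos he hps
    obtain ⟨P, F, Q, rfl, hP, hF, hQ, hFN, hPN, hQN, hPQ, hQ1⟩ :=
      exists_factorization hp hA hsa he (fun σ hσ => ih σ hσ (by omega)) hD hDe
        (Nat.le_mul_of_pos_right e hps) le_rfl
    -- `P * F` obeys the Leibniz rule in degree `e p^s` and `F ≡ 1 + F_{e p^s} t^(e p^s)`, so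
    -- `F_{e p^s}` compensates the defect of `P`, which is that of `Q` in degree `p^s`
    refine ⟨Q + PowerSeries.monomial (p ^ s) (PowerSeries.coeff (e * p ^ s) F),
      hQ.add_monomial hps _, fun x y => ?_, ?_,
      PowerSeries.coeff (p ^ s) Q - PowerSeries.coeff (e * p ^ s) P, hQN.sub hPN, ?_⟩
    · rw [leibnizDefect_add_monomial hps hQ.coeff_zero, ← hPQ,
        ← leibnizDefect_of_coeff_eq_zero hN hF.coeff_zero hFN,
        ← leibnizDefect_mul hP.coeff_zero hF.coeff_zero hP.defect hF.defect, hDN]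
    · -- the added monomial meets degree `1` only if `p^s = 1`, and then `e p^s = e`
      rw [hQ1, map_add, PowerSeries.coeff_monomial]
      split_ifs with h1
      · rw [← h1, mul_one]
      · rw [hFN e he (lt_mul_of_one_lt_right he (by omega))]
    · rw [coeff_mul_eq_add hN hP.coeff_zero hF.coeff_zero fun u v hu hv huv => by
        rw [hFN v hv (by omega), mul_zero], map_add, PowerSeries.coeff_monomial, if_pos rfl]
      abel

end Factorization

theorem theorem3p14 {k A : Type*} [CommRing k] [CommRing A] [Algebra k A] (I : Ideal A)
    (p : ℕ) (hp : 2 ≤ p) (a : ℕ) (ha : 1 ≤ a) (hA : NoLogLeapsBelow k I p a)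
    (e s : ℕ) (he : 1 ≤ e) (hs : 1 ≤ s) (hsa : s ≤ a)
    (D : HSDer k A (e * p ^ s)) (hD : D.IsLogarithmicUpTo I (e * p ^ s - 1))
    (hell : (e : ℕ∞) ≤ D.ell) :
    ∃ D' : HSDer k A (p ^ s),
      D'.IsIntegralOf (D.comp e) ∧ D'.IsLogarithmicUpTo I (p ^ s - 1) ∧
        ∃ H : Module.End k A, IsLogDiffOp I H ∧
          D'.comp (p ^ s) = D.comp (e * p ^ s) + H := by
  have hps : 0 < p ^ s := by positivity
  obtain ⟨G, hG, hGd, hG1, H, hH, hGH⟩ := hasPowIntegrals hp hA hsa e he (PowerSeries.mk D.comp)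
    (D.isLogHSMod_mk (by omega) fun i hi => hD i (by omega)) (D.leibnizDefect_mk le_rfl)
    (fun i hi hie => by rw [PowerSeries.coeff_mk]; exact (D.le_ell_iff e).1 hell i hi hie)
  have hGd' : ∀ i ≤ p ^ s, ∀ x y, leibnizDefect G i x y = 0 := fun i hi => by
    rcases hi.lt_or_eq with hi | rfl
    exacts [hG.defect i hi, hGd]
  rw [PowerSeries.coeff_mk] at hG1 hGH
  refine ⟨HSDer.ofSeries (p ^ s) G hG.coeff_zero hGd', ⟨hps, ?_⟩, fun i hi x hx => ?_, H, hH, ?_⟩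
  · rw [HSDer.ofSeries_comp _ _ hps, hG1]
  · rw [HSDer.ofSeries_comp _ _ (by omega)]
    exact hG.log i (by omega) x hx
  · rw [HSDer.ofSeries_comp _ _ le_rfl, hGH]
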